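/- Let $R=K[x_1,\dots,x_n]$ be the polynomial ring in $n\ge 0$ variables over a field $K$, and let $\mathfrak m=(x_1,\dots,x_n)$. For a monomial ideal $I$ let $G(I)$ be its set of minimal monomial generators and let $\operatorname{supp}(I)$ be the set of variables that divide some element of $G(I)$. A nonzero monomial ideal $I$ is called polymatroidal of degree $d$ if all elements of $G(I)$ have degree $d$ and for all $u,v\in G(I)$ and every $i$ with $\deg_{x_i}(v)<\deg_{x_i}(u)$ there is a $j$ with $\deg_{x_j}(u)<\deg_{x_j}(v)$ and $x_j(u/x_i)\in G(I)$; it is called matroidal if moreover all elements of $G(I)$ are squarefree. An ideal $I$ is called unmixed if all associated primes of $R/I$ have the same height. A monomial prime is a prime ideal that is a monomial ideal. **Theorem.** Let $I\subseteq R$ be a polymatroidal ideal of degree $d\ge 0$. Then $I$ is unmixed if and only if at least one of the following holds: 1. $I=\mathfrak m^d$. 2. $I=\mathfrak p_1^{a_1}\cdots\mathfrak p_t^{a_t}$ for some $t\ge 1$, integers $a_i\ge 1$ with $\sum_{i=1}^t a_i=d$, and monomial primes $\mathfrak p_1,\dots,\mathfrak p_t$, all of the same height, with $\operatorname{supp}(\mathfrak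 p_i)\cap\operatorname{supp}(\mathfrak p_j)=\emptyset$ for all $i\neq j$. 3. $I=\mathfrak p_1^{a_1}\cdots\mathfrak p_t^{a_t}J$ for some $t\ge 1$, integers $a_i\ge 1$, monomial primes $\mathfrak p_1,\dots,\mathfrak p_t$ and an unmixed matroidal ideal $J$ of degree $e$ such that $\operatorname{height}(\mathfrak p_i)=\operatorname{height}(\mathfrak p_j)=\operatorname{height}(J)$ for all $i,j$, $\operatorname{supp}(\mathfrak p_i)\cap\operatorname{supp}(\mathfrak p_j)=\emptyset$ for all $i\ne j$, $\operatorname{supp}(\mathfrak p_i)\cap\operatorname{supp}(J)=\emptyset$ for all $i$, and $\sum_{i=1}^t a_i+e=d$. 4. $I$ is an unmixed matroidal ideal of degree $d$. -/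

import Mathlib

namespace Polymatroidal

open MvPolynomial

noncomputable section

/-- An ideal of `K[x₁, …, xₙ]` is a monomial ideal if it is generated by a set of monomials. -/
def IsMonomialIdeal {n : ℕ} {K : Type*} [Field K] (I : Ideal (MvPolynomial (Fin n) K)) : Prop :=
  ∃ S : Set (Fin n →₀ ℕ), I = Ideal.span ((fun u => monomial u (1 : K)) '' S)

/-- The set `G(I)` of minimal monomial generators of a monomial ideal `I`, by exponent vectors:
the monomials of `I` that are minimal with respect to divisibility. -/
def minGens {n : ℕ} {K : Type*} [Field K] (I : Ideal (MvPolynomial (Fin n) K)) :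
    Set (Fin n →₀ ℕ) :=
  {u | Minimal (fun v : Fin n →₀ ℕ => monomial v (1 : K) ∈ I) u}

/-- The support of a monomial ideal: the variables that divide some minimal monomial generator. -/
def supp {n : ℕ} {K : Type*} [Field K] (I : Ideal (MvPolynomial (Fin n) K)) : Set (Fin n) :=
  {i | ∃ u ∈ minGens I, u i ≠ 0}

/-- `I` is a (nonzero) polymatroidal ideal of degree `d`: a monomial ideal generated in the single
degree `d` whose minimal monomial generators satisfy the exchange condition. In `exchange`, the
exponent vector `u - single i 1 + single j 1` is that of `x_j (u / x_i)`; here `x_i` divides `u`,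
so the subtraction is exact. -/
structure IsPolymatroidal {n : ℕ} {K : Type*} [Field K] (I : Ideal (MvPolynomial (Fin n) K))
    (d : ℕ) : Prop where
  isMonomialIdeal : IsMonomialIdeal I
  ne_bot : I ≠ ⊥
  degree_eq : ∀ u ∈ minGens I, u.degree = d
  exchange : ∀ u ∈ minGens I, ∀ v ∈ minGens I, ∀ i, v i < u i →
    ∃ j, u j < v j ∧ u - Finsupp.single i 1 + Finsupp.single j 1 ∈ minGens I

/-- `I` is a matroidal ideal of degree `d`: a polymatroidal ideal of degree `d` generated by
squarefree monomials. -/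
structure IsMatroidal {n : ℕ} {K : Type*} [Field K] (I : Ideal (MvPolynomial (Fin n) K))
    (d : ℕ) : Prop extends IsPolymatroidal I d where
  squarefree : ∀ u ∈ minGens I, ∀ i, u i ≤ 1

/-- An ideal `I` of `R` is unmixed if all associated primes of `R ⧸ I` have the same height. -/
def IsUnmixed {R : Type*} [CommRing R] (I : Ideal R) : Prop :=
  ∀ P ∈ associatedPrimes R (R ⧸ I), ∀ Q ∈ associatedPrimes R (R ⧸ I), P.height = Q.height

end

end Polymatroidal

/-!
The exponent vectors of the generators of a polymatroidal ideal `I` of degree `d` are the bases `G`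
of a discrete polymatroid. For a vector `w` of degree `d - 1` below some base, let `link G w` be the
set of indices `j` with `w + single j 1 ∈ G`. The exchange property gives `I : x ^ w = (x_j : j ∈
link G w)`, so the monomial prime of every nonempty link is associated
(`IsBaseSet.varIdeal_link_mem_associatedPrimes`). If `I` is unmixed, then these primes all have the
same height, so a nonempty link that is contained in another link is equal to it
(`IsBaseSet.link_eq_of_subset`). The combinatorial part uses nothing else about unmixedness.

The second ingredient is that, if `w + 2 e_j ∈ G`, then `link G (w + e_k) ⊆ link G (w + e_j)` for
every `k` (`IsBaseSet.link_subset`), hence equality in the unmixed case. Suppose that a base `u` has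
an entry `u l ≥ 2`. Put `A = link G (u - e_l)` and let `c ≥ 2` be the degree of `u` on `A`. The
equality of links shows that the part of `u` on `A` may be replaced by any vector of degree `c` on
`A`, and that the link stays `A` (`IsBaseSet.exists_isBlock`). Exchanging against these vectors
shows that every base has degree exactly `c` on `A` (`IsBlock.mass_eq`) and that its part on `A` is
arbitrary. So `I = 𝔭 ^ c * I'`, where `𝔭` is the associated prime generated by the variables in `A`
and `I'` is polymatroidal in the other variables (`IsPolymatroidal.exists_splitOff`). The associated
primes of `I'` are associated to `I`, so `I'` is again unmixed; induction on the degree ends with a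
squarefree factor (`IsPolymatroidal.exists_factorization`).

Conversely, powers of monomial primes are primary, which follows from the additivity of the order in
the variables of `A`, and for factors in disjoint sets of variables the product is the intersection.
Therefore the associated primes of a product as in the theorem are among those of its factors
(`associatedPrimes_prod_mul`), and they all have the same height.
-/

namespace Polymatroidal

open MvPolynomial Finsupp

noncomputable section

/-! ### Links and blocks in discrete polymatroids -/

/-- `G` is the set of (exponent vectors of) bases of a discrete polymatroid of rank `d`. The
exchange condition is written additively, `w + single i 1` being the vector that gives up one unit
in coordinate `i`, so that no truncated subtraction occurs. -/
structure IsBaseSet {n : ℕ} (G : Set (Fin n →₀ ℕ)) (d : ℕ) : Prop where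
  nonempty : G.Nonempty
  degree_eq : ∀ u ∈ G, u.degree = d
  exchange : ∀ w i, w + single i 1 ∈ G → ∀ v ∈ G, v i ≤ w i →
    ∃ j, (w + single i 1 : Fin n →₀ ℕ) j < v j ∧ w + single j 1 ∈ G

/-- The indices that complete `w` to an element of `G`. -/
def link {n : ℕ} (G : Set (Fin n →₀ ℕ)) (w : Fin n →₀ ℕ) : Set (Fin n) :=
  {j | w + single j 1 ∈ G}

/-- The total degree of `u` in the variables of `A`. -/
def mass {n : ℕ} (A : Set (Fin n)) : (Fin n →₀ ℕ) →+ ℕ := weight (A.indicator 1)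

variable {n d : ℕ} {G : Set (Fin n →₀ ℕ)} {A : Set (Fin n)}

theorem mem_link {w : Fin n →₀ ℕ} {j : Fin n} : j ∈ link G w ↔ w + single j 1 ∈ G := Iff.rfl

theorem mass_single_of_mem {i : Fin n} (hi : i ∈ A) (k : ℕ) : mass A (single i k) = k := by
  simp [mass, weight_single, hi]

theorem mass_single_of_notMem {i : Fin n} (hi : i ∉ A) (k : ℕ) : mass A (single i k) = 0 := by
  simp [mass, weight_single, hi]

theorem mass_eq_degree {u : Fin n →₀ ℕ} (hu : ∀ i ∉ A, u i = 0) : mass A u = u.degree := by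
  rw [mass, weight_apply, degree_apply]
  refine Finset.sum_congr rfl fun i _ => ?_
  by_cases hi : i ∈ A
  · simp [hi]
  · simp [hi, hu i hi]

theorem mass_eq_zero {u : Fin n →₀ ℕ} (hu : ∀ i ∈ A, u i = 0) : mass A u = 0 := by
  rw [mass, weight_apply]
  refine Finset.sum_eq_zero fun i _ => ?_
  by_cases hi : i ∈ A
  · simp [hu i hi]
  · simp [hi]

theorem mass_mono {u v : Fin n →₀ ℕ} (huv : u ≤ v) : mass A u ≤ mass A v := by
  rw [← tsub_add_cancel_of_le huv, map_add]
  omega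

/-- Every exponent vector splits into a part off `A` and a part on `A`. -/
theorem exists_split (A : Set (Fin n)) (u : Fin n →₀ ℕ) :
    ∃ z m : Fin n →₀ ℕ, u = z + m ∧ (∀ i ∈ A, z i = 0) ∧ ∀ i ∉ A, m i = 0 := by
  classical
  refine ⟨u.filter (· ∉ A), u.filter (· ∈ A), ?_, ?_, ?_⟩
  · rw [add_comm]
    exact (filter_add_filter_not u (· ∈ A)).symm
  · intro i hi
    simp [hi]
  · intro i hi
    simp [hi]

theorem exists_eq_add_single {u : Fin n →₀ ℕ} {i : Fin n} (h : u i ≠ 0) :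
    ∃ w, u = w + single i 1 := by
  refine ⟨u - single i 1, (tsub_add_cancel_of_le ?_).symm⟩
  rw [single_le_iff]
  omega

theorem exists_ne_zero_of_degree_ne_zero {u : Fin n →₀ ℕ} (h : u.degree ≠ 0) : ∃ i, u i ≠ 0 := by
  by_contra! hu
  exact h ((degree_eq_zero_iff u).2 (Finsupp.ext hu))

/-- Two vectors on `A` of the same degree are connected by moving single units within `A`. -/
theorem transfer_of_moves (N : ℕ) : ∀ (Q : (Fin n →₀ ℕ) → Prop),
    (∀ m j k, (∀ i ∉ A, m i = 0) → j ∈ A → k ∈ A → Q (m + single j 1) → Q (m + single k 1)) →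
    ∀ m m' : Fin n →₀ ℕ, (∀ i ∉ A, m i = 0) → (∀ i ∉ A, m' i = 0) →
      m.degree = N → m'.degree = N → Q m → Q m' := by
  induction N with
  | zero =>
    intro Q _ m m' _ _ h h' hm
    rw [degree_eq_zero_iff] at h h'
    rwa [h', ← h]
  | succ N ih =>
    intro Q hQ m m' hA hA' h h' hm
    obtain ⟨j, hj⟩ := exists_ne_zero_of_degree_ne_zero (u := m) (by omega)
    obtain ⟨k, hk⟩ := exists_ne_zero_of_degree_ne_zero (u := m') (by omega)
    have hjA : j ∈ A := by_contra fun h0 => hj (hA j h0)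
    have hkA : k ∈ A := by_contra fun h0 => hk (hA' k h0)
    obtain ⟨w, rfl⟩ := exists_eq_add_single hj
    obtain ⟨w', rfl⟩ := exists_eq_add_single hk
    have hw : ∀ i ∉ A, w i = 0 := fun i hi => by
      have := hA i hi
      rw [Finsupp.add_apply] at this
      omega
    have hw' : ∀ i ∉ A, w' i = 0 := fun i hi => by
      have := hA' i hi
      rw [Finsupp.add_apply] at this
      omega
    rw [map_add, degree_single] at h h'
    refine ih (fun x => Q (x + single k 1)) ?_ w w' hw hw' (by omega) (by omega)
      (hQ w j k hw hjA hkA hm)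
    intro x a b hx ha hb hxa
    have hxk : ∀ i ∉ A, (x + single k 1 : Fin n →₀ ℕ) i = 0 := by
      intro i hi
      have : k ≠ i := fun e => hi (e ▸ hkA)
      simp [hx i hi, this]
    rw [add_right_comm] at hxa ⊢
    exact hQ _ a b hxk ha hb hxa

/-- If coordinate `j` can be doubled, then giving up a unit in `j` leaves the most freedom. -/
theorem IsBaseSet.link_subset (hG : IsBaseSet G d) {w : Fin n →₀ ℕ} {j : Fin n} (k : Fin n)
    (hj : w + single j 1 + single j 1 ∈ G) :
    link G (w + single k 1) ⊆ link G (w + single j 1) := by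
  intro x hx
  rw [mem_link] at hx ⊢
  by_cases hkj : k = j
  · rwa [← hkj]
  by_cases hxj : x = j
  · rwa [hxj]
  rw [add_right_comm] at hx
  obtain ⟨y, hy, hyG⟩ := hG.exchange _ _ hx _ hj (by simp [Ne.symm hkj])
  have : y = j := by
    by_contra hyj
    simp [single_apply, Ne.symm hyj] at hy
    omega
  rw [add_right_comm]
  rwa [this] at hyG

/-- The data from which a power of a monomial prime splits off. All vectors `z + m` with `m` on `A`
of degree `c` lie in `G`, and whenever such a vector gives up a unit in `A`, the indices that may
replace it are exactly those of `A`. -/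
structure IsBlock (G : Set (Fin n →₀ ℕ)) (A : Set (Fin n)) (z : Fin n →₀ ℕ) (c : ℕ) : Prop where
  nonempty : A.Nonempty
  two_le : 2 ≤ c
  off : ∀ i ∈ A, z i = 0
  link_eq : ∀ m : Fin n →₀ ℕ, (∀ i ∉ A, m i = 0) → m.degree + 1 = c → link G (z + m) = A

/-- An exponent at least two produces a block, provided links are pairwise incomparable. -/
theorem IsBaseSet.exists_isBlock (hG : IsBaseSet G d)
    (hH : ∀ w w', (link G w).Nonempty → link G w ⊆ link G w' → link G w = link G w')
    {u : Fin n →₀ ℕ} (hu : u ∈ G) {l : Fin n} (hl : 2 ≤ u l) :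
    ∃ w A z c, A = link G w ∧ IsBlock G A z c := by
  obtain ⟨w, rfl⟩ := exists_eq_add_single (u := u) (i := l) (by omega)
  have hw : 1 ≤ w l := by simpa using hl
  have hlA : l ∈ link G w := hu
  obtain ⟨z, m, hzm, hz, hm⟩ := exists_split (link G w) w
  have hml : 1 ≤ m l := by
    rw [hzm, Finsupp.add_apply, hz l hlA] at hw
    omega
  refine ⟨w, link G w, z, m.degree + 1, rfl, ⟨l, hlA⟩, ?_, hz, ?_⟩
  · have := le_degree l m
    omega
  intro m' hm' hdeg
  refine transfer_of_moves (A := link G w) m.degree (fun x => link G (z + x) = link G w) ?_ m m'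
    hm hm' rfl (by omega) (by rw [← hzm])
  intro x j k hx hj hk hjx
  have hjj : z + x + single j 1 + single j 1 ∈ G := by
    rw [← hjx] at hj
    rwa [mem_link, ← add_assoc] at hj
  have hkj : z + x + single j 1 + single k 1 ∈ G := by
    rw [← hjx] at hk
    rwa [mem_link, ← add_assoc] at hk
  rw [← add_assoc] at hjx ⊢
  rw [← hjx]
  refine hH _ _ ⟨j, ?_⟩ (hG.link_subset k hjj)
  rwa [mem_link, add_right_comm]

namespace IsBlock

variable {z : Fin n →₀ ℕ} {c : ℕ}

theorem add_mem (hB : IsBlock G A z c) {m : Fin n →₀ ℕ} (hm : ∀ i ∉ A, m i = 0)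
    (hc : m.degree = c) : z + m ∈ G := by
  have := hB.two_le
  obtain ⟨j, hj⟩ := exists_ne_zero_of_degree_ne_zero (u := m) (by omega)
  have hjA : j ∈ A := by_contra fun h0 => hj (hm j h0)
  obtain ⟨w, rfl⟩ := exists_eq_add_single hj
  rw [map_add, degree_single] at hc
  have hw : ∀ i ∉ A, w i = 0 := fun i hi => by
    have := hm i hi
    rw [Finsupp.add_apply] at this
    omega
  rw [← hB.link_eq w hw hc, mem_link] at hjA
  rwa [← add_assoc]

theorem le_mass (hB : IsBlock G A z c) (hG : IsBaseSet G d) {v : Fin n →₀ ℕ} (hv : v ∈ G) :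
    c ≤ mass A v := by
  by_contra! hlt
  obtain ⟨y, m, rfl, hy, hm⟩ := exists_split A v
  rw [map_add, mass_eq_zero hy, mass_eq_degree hm, zero_add] at hlt
  obtain ⟨l, hl⟩ := hB.nonempty
  have hoff : ∀ i ∉ A, l ≠ i := fun i hi e => hi (e ▸ hl)
  -- pad `m` at `l` to degree `c`; the exchange of a unit at `l` towards `v` must then stay in `A`,
  -- where `v` has no larger entry
  have hlink := hB.link_eq (m + single l (c - 1 - m.degree))
    (fun i hi => by simp [hm i hi, hoff i hi])
    (by rw [map_add, degree_single]; omega)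
  have hlG := hl
  rw [← hlink] at hlG
  obtain ⟨x, hx, hxG⟩ := hG.exchange _ _ hlG _ hv (by simp [hy l hl, hB.off l hl])
  have hxA : x ∈ A := hlink ▸ hxG
  simp [hy x hxA, hB.off x hxA] at hx
  omega

/-- No unit of `z` can be moved into the block: otherwise its coordinate `i` would belong to a
link that is comparable with `A`, hence equal to it. -/
theorem add_notMem (hB : IsBlock G A z c) (hG : IsBaseSet G d)
    (hH : ∀ w w', (link G w).Nonempty → link G w ⊆ link G w' → link G w = link G w')
    {z' : Fin n →₀ ℕ} {i : Fin n} (hz : z = z' + single i 1) (hi : i ∉ A)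
    {M : Fin n →₀ ℕ} (hM : ∀ i ∉ A, M i = 0) : z' + M ∉ G := by
  intro hMG
  obtain ⟨l, hl⟩ := hB.nonempty
  have h2 := hB.two_le
  have hoff : ∀ i ∉ A, l ≠ i := fun i hi e => hi (e ▸ hl)
  have hu : z + single l c ∈ G :=
    hB.add_mem (fun i hi => by simp [hoff i hi]) (degree_single l c)
  rw [hz, add_right_comm] at hu
  -- exchange the unit at `i` in `z + c e_l`, which puts at least two units at `l`
  obtain ⟨x, hx, hxG⟩ := hG.exchange _ _ hu _ hMG (by simp [hM i hi])
  have hxA : x ∈ A := by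
    by_contra hxA
    simp [hM x hxA] at hx
    omega
  obtain ⟨b, rfl⟩ : ∃ b, c = b + 2 := ⟨c - 2, by omega⟩
  have key : z' + single l (b + 2) + single x 1 =
      (z' + single l b + single x 1) + single l 1 + single l 1 := by
    rw [show b + 2 = b + 1 + 1 from rfl, single_add, single_add]
    abel
  rw [key] at hxG
  have hlink : link G (z' + single l b + single x 1 + single i 1) = A := by
    have := hB.link_eq (single l b + single x 1)
      (fun k hk => by
        have : x ≠ k := fun e => hk (e ▸ hxA)
        simp [hoff k hk, this])
      (by rw [map_add, degree_single, degree_single])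
    rw [← this, hz]
    congr 1
    abel
  -- now `l` can be doubled, so the link `A` is also the link obtained by giving up a unit at `l`
  have heq := hH _ _ (by rw [hlink]; exact ⟨l, hl⟩) (hG.link_subset i hxG)
  apply hi
  rw [← hlink, heq, mem_link, add_right_comm, ← mem_link, hlink]
  exact hl

theorem mass_le (hB : IsBlock G A z c) (hG : IsBaseSet G d)
    (hH : ∀ w w', (link G w).Nonempty → link G w ⊆ link G w' → link G w = link G w')
    {v : Fin n →₀ ℕ} (hv : v ∈ G) : mass A v ≤ c := by
  by_contra! hlt
  -- a subvector `m + single j 1` of the `A`-part of `v`, of degree `c + 1`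
  obtain ⟨m, j, hm, hj, hdeg, hle⟩ : ∃ (m : Fin n →₀ ℕ) (j : Fin n), (∀ i ∉ A, m i = 0) ∧ j ∈ A ∧
      m.degree = c ∧ ∀ i ∈ A, (m + single j 1 : Fin n →₀ ℕ) i ≤ v i := by
    obtain ⟨y, m, rfl, hy, hm⟩ := exists_split A v
    rw [map_add, mass_eq_zero hy, mass_eq_degree hm, zero_add] at hlt
    obtain ⟨M, hMm, hMc⟩ : ∃ M ≤ m, M.degree = c + 1 := exists_le_degree_eq m _ hlt
    obtain ⟨j, hj⟩ := exists_ne_zero_of_degree_ne_zero (u := M) (by omega)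
    obtain ⟨m', rfl⟩ := exists_eq_add_single hj
    have hM : ∀ i ∉ A, (m' + single j 1 : Fin n →₀ ℕ) i = 0 := fun i hi => by
      have := hMm i
      rw [hm i hi] at this
      omega
    rw [map_add, degree_single] at hMc
    refine ⟨m', j, fun i hi => ?_, by_contra fun h0 => hj (hM j h0), by omega, fun i hi => ?_⟩
    · have := hM i hi
      rw [Finsupp.add_apply] at this
      omega
    · have := hMm i
      rw [Finsupp.add_apply y]
      omega
  have hjoff : ∀ i ∉ A, j ≠ i := fun i hi e => hi (e ▸ hj)
  have hzm : z + m ∈ G := hB.add_mem hm hdeg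
  clear hlt
  -- exchanging towards `z + m` decreases the excess of `v` over `z + m + single j 1`
  induction hN : (v - (z + (m + single j 1))).degree using Nat.strong_induction_on generalizing v
    with
  | h N ih =>
  by_cases hvle : v ≤ z + (m + single j 1)
  · obtain ⟨r, hr⟩ := exists_add_of_le hvle
    have hrd : r.degree = 1 := by
      have h1 := congrArg degree hr
      have h2 := hG.degree_eq _ hzm
      have h3 := hG.degree_eq _ hv
      rw [← add_assoc, map_add, map_add _ v, degree_single] at h1
      omega
    obtain ⟨i, rfl⟩ : ∃ i, r = single i 1 := by
      obtain ⟨i, hi⟩ := exists_ne_zero_of_degree_ne_zero (u := r) (by omega)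
      obtain ⟨s, rfl⟩ := exists_eq_add_single hi
      rw [map_add, degree_single] at hrd
      have : s = 0 := (degree_eq_zero_iff s).1 (by omega)
      exact ⟨i, by simp [this]⟩
    have hri := DFunLike.congr_fun hr i
    have hiA : i ∉ A := by
      intro hiA
      have h1 := hle i hiA
      have h2 := hB.off i hiA
      simp only [Finsupp.add_apply, single_eq_same] at hri h1
      omega
    have hzi : z i ≠ 0 := by
      simp only [Finsupp.add_apply, single_eq_same, hm i hiA,
        single_eq_of_ne (hjoff i hiA).symm] at hri
      omega
    obtain ⟨z', hz'⟩ := exists_eq_add_single hzi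
    refine hB.add_notMem hG hH hz' hiA (M := m + single j 1)
      (fun k hk => by simp [hm k hk, hjoff k hk]) ?_
    rw [hz', add_right_comm] at hr
    rwa [add_right_cancel hr]
  · obtain ⟨i, hi⟩ : ∃ i, (z + (m + single j 1) : Fin n →₀ ℕ) i < v i := by
      by_contra! h0
      exact hvle h0
    obtain ⟨w, rfl⟩ := exists_eq_add_single (u := v) (i := i) (by omega)
    obtain ⟨x, hx, hxG⟩ := hG.exchange w i hv _ hzm (by
      simp only [Finsupp.add_apply, single_eq_same] at hi ⊢
      omega)
    have hxA : x ∉ A := by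
      intro hxA
      have h1 := hle x hxA
      simp only [Finsupp.add_apply, hB.off x hxA] at hx h1
      omega
    have hxi : x ≠ i := by
      rintro rfl
      simp only [Finsupp.add_apply] at hx hi
      omega
    refine ih _ ?_ hxG ?_ rfl
    · rw [← hN]
      have : w + single i 1 - (z + (m + single j 1)) =
          (w + single x 1 - (z + (m + single j 1))) + single i 1 := by
        ext k
        simp only [Finsupp.add_apply, Finsupp.tsub_apply] at hx hi ⊢
        by_cases hki : k = i
        · subst hki
          simp only [single_eq_same, single_eq_of_ne hxi.symm] at hi ⊢
          omega
        · by_cases hkx : k = x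
          · subst hkx
            simp only [single_eq_same, single_eq_of_ne hki] at hx ⊢
            omega
          · simp [single_eq_of_ne hki, single_eq_of_ne hkx]
      rw [this, map_add, degree_single]
      omega
    · intro k hk
      have h1 := hle k hk
      have hkx : k ≠ x := fun e => hxA (e ▸ hk)
      by_cases hki : k = i
      · subst hki
        simp only [Finsupp.add_apply, single_eq_same, single_eq_of_ne hkx] at hi ⊢
        omega
      · simp only [Finsupp.add_apply, single_eq_of_ne hki, single_eq_of_ne hkx] at h1 ⊢
        omega

theorem mass_eq (hB : IsBlock G A z c) (hG : IsBaseSet G d)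
    (hH : ∀ w w', (link G w).Nonempty → link G w ⊆ link G w' → link G w = link G w')
    {v : Fin n →₀ ℕ} (hv : v ∈ G) : mass A v = c :=
  (hB.mass_le hG hH hv).antisymm (hB.le_mass hG hv)

/-- Units move freely inside the block. -/
theorem move (hB : IsBlock G A z c) (hG : IsBaseSet G d)
    (hH : ∀ w w', (link G w).Nonempty → link G w ⊆ link G w' → link G w = link G w')
    {w : Fin n →₀ ℕ} {i k : Fin n} (hi : i ∈ A) (hk : k ∈ A) (hw : w + single i 1 ∈ G) :
    w + single k 1 ∈ G := by
  by_cases hik : i = k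
  · rwa [← hik]
  have hoff : ∀ x ∉ A, k ≠ x := fun x hx e => hx (e ▸ hk)
  have hu : z + single k c ∈ G :=
    hB.add_mem (fun x hx => by simp [hoff x hx]) (degree_single k c)
  obtain ⟨x, hx, hxG⟩ := hG.exchange _ _ hw _ hu (by simp [hB.off i hi, Ne.symm hik])
  have h1 := hB.mass_eq hG hH hw
  have h2 := hB.mass_eq hG hH hxG
  rw [map_add, mass_single_of_mem hi] at h1
  have hxA : x ∈ A := by
    by_contra hxA
    rw [map_add, mass_single_of_notMem hxA] at h2
    omega
  have hxk : x = k := by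
    by_contra hxk
    simp [hB.off x hxA, Ne.symm hxk] at hx
  rwa [hxk] at hxG

/-- The part on `A` of an element of `G` may be replaced by any vector on `A` of degree `c`. -/
theorem replace (hB : IsBlock G A z c) (hG : IsBaseSet G d)
    (hH : ∀ w w', (link G w).Nonempty → link G w ⊆ link G w' → link G w = link G w')
    {y m m' : Fin n →₀ ℕ} (hy : ∀ i ∈ A, y i = 0) (hm : ∀ i ∉ A, m i = 0) (hym : y + m ∈ G)
    (hm' : ∀ i ∉ A, m' i = 0) (hc : m'.degree = c) : y + m' ∈ G := by
  have h1 := hB.mass_eq hG hH hym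
  rw [map_add, mass_eq_zero hy, mass_eq_degree hm, zero_add] at h1
  refine transfer_of_moves (A := A) c (fun x => y + x ∈ G) ?_ m m' hm hm' h1 hc hym
  intro x j k _ hj hk hx
  rw [← add_assoc] at hx ⊢
  exact hB.move hG hH hj hk hx

end IsBlock

/-- The vectors off `A` that are completed to elements of `G` by a vector on `A`. -/
def offPart (G : Set (Fin n →₀ ℕ)) (A : Set (Fin n)) : Set (Fin n →₀ ℕ) :=
  {y | (∀ i ∈ A, y i = 0) ∧ ∃ m : Fin n →₀ ℕ, (∀ i ∉ A, m i = 0) ∧ y + m ∈ G}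

namespace IsBlock

variable {z : Fin n →₀ ℕ} {c : ℕ}

open Pointwise in
/-- `G` is the sumset of the vectors of degree `c` on `A` and of the parts of bases off `A`. -/
theorem eq_add_offPart (hB : IsBlock G A z c) (hG : IsBaseSet G d)
    (hH : ∀ w w', (link G w).Nonempty → link G w ⊆ link G w' → link G w = link G w') :
    G = {m | (∀ i ∉ A, m i = 0) ∧ m.degree = c} + offPart G A := by
  ext v
  rw [Set.mem_add]
  constructor
  · intro hv
    have h1 := hB.mass_eq hG hH hv
    obtain ⟨y, m, rfl, hy, hm⟩ := exists_split A v
    rw [map_add, mass_eq_zero hy, mass_eq_degree hm, zero_add] at h1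
    exact ⟨m, ⟨hm, h1⟩, y, ⟨hy, m, hm, hv⟩, add_comm _ _⟩
  · rintro ⟨m, ⟨hm, hc⟩, y, ⟨hy, m', hm', hv⟩, rfl⟩
    rw [add_comm]
    exact hB.replace hG hH hy hm' hv hm hc

theorem isBaseSet_offPart (hB : IsBlock G A z c) (hG : IsBaseSet G d)
    (hH : ∀ w w', (link G w).Nonempty → link G w ⊆ link G w' → link G w = link G w') :
    ∃ d', c + d' = d ∧ IsBaseSet (offPart G A) d' := by
  obtain ⟨l, hl⟩ := hB.nonempty
  have hoff : ∀ i ∉ A, single l c i = 0 := fun i hi => by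
    have : i ≠ l := fun e => hi (e ▸ hl)
    exact single_eq_of_ne this
  have hmem : ∀ y, y ∈ offPart G A ↔ (∀ i ∈ A, y i = 0) ∧ y + single l c ∈ G := by
    intro y
    constructor
    · rintro ⟨hy, m, hm, hv⟩
      exact ⟨hy, hB.replace hG hH hy hm hv hoff (degree_single l c)⟩
    · rintro ⟨hy, hv⟩
      exact ⟨hy, _, hoff, hv⟩
  have hz : z ∈ offPart G A := (hmem z).2 ⟨hB.off, hB.add_mem hoff (degree_single l c)⟩
  have hdeg : ∀ y ∈ offPart G A, y.degree + c = d := by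
    intro y hy
    rw [← hG.degree_eq _ ((hmem y).1 hy).2, map_add, degree_single]
  have hzd := hdeg z hz
  refine ⟨z.degree, by omega, ⟨z, hz⟩, fun y hy => ?_, ?_⟩
  · have := hdeg y hy
    omega
  intro w i hw v hv hiv
  rw [hmem] at hw hv
  have hiA : i ∉ A := fun hi => by simpa using hw.1 i hi
  have hwA : ∀ k ∈ A, w k = 0 := fun k hk => by
    have := hw.1 k hk
    rw [Finsupp.add_apply] at this
    omega
  have hw2 := hw.2
  rw [add_right_comm] at hw2
  obtain ⟨x, hx, hxG⟩ := hG.exchange _ _ hw2 _ hv.2 (by simpa using hiv)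
  have hxlt : (w + single i 1 : Fin n →₀ ℕ) x < v x := by
    simp only [Finsupp.add_apply] at hx ⊢
    omega
  have hxA : x ∉ A := fun hxA => by
    rw [hv.1 x hxA] at hxlt
    omega
  refine ⟨x, hxlt, (hmem _).2 ⟨fun k hk => ?_, by rwa [add_right_comm]⟩⟩
  have : x ≠ k := fun e => hxA (e ▸ hk)
  simp [hwA k hk, this]

end IsBlock

/-! ### Monomial ideals -/

variable {K : Type*} [Field K] {S T : Set (Fin n →₀ ℕ)}

variable (K) in
/-- The ideal generated by the monomials with exponent vectors in `S`. -/
def monIdeal {n : ℕ} (S : Set (Fin n →₀ ℕ)) : Ideal (MvPolynomial (Fin n) K) :=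
  Ideal.span ((fun u => monomial u (1 : K)) '' S)

variable (K) in
/-- The monomial prime generated by the variables in `A`. -/
def varIdeal {n : ℕ} (A : Set (Fin n)) : Ideal (MvPolynomial (Fin n) K) :=
  Ideal.span (X '' A)

theorem mem_monIdeal {f : MvPolynomial (Fin n) K} :
    f ∈ monIdeal K S ↔ ∀ u ∈ f.support, ∃ s ∈ S, s ≤ u :=
  mem_ideal_span_monomial_image

theorem monomial_mem_monIdeal {u : Fin n →₀ ℕ} :
    monomial u (1 : K) ∈ monIdeal K S ↔ ∃ s ∈ S, s ≤ u := by
  classical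
  rw [mem_monIdeal, support_monomial, if_neg one_ne_zero]
  simp

theorem mul_monomial_mem_monIdeal {f : MvPolynomial (Fin n) K} {w : Fin n →₀ ℕ} :
    f * monomial w 1 ∈ monIdeal K S ↔ ∀ u ∈ f.support, ∃ s ∈ S, s ≤ u + w := by
  classical
  rw [mem_monIdeal]
  constructor
  · intro h u hu
    refine h (u + w) ?_
    rw [MvPolynomial.mem_support_iff, coeff_mul_monomial, mul_one]
    exact MvPolynomial.mem_support_iff.1 hu
  · intro h u hu
    rw [MvPolynomial.mem_support_iff, coeff_mul_monomial', mul_one] at hu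
    split_ifs at hu with hw
    · obtain ⟨s, hs, hsu⟩ := h _ (MvPolynomial.mem_support_iff.2 hu)
      exact ⟨s, hs, by rwa [tsub_add_cancel_of_le hw] at hsu⟩
    · exact absurd rfl hu

theorem minGens_monIdeal (hS : ∀ u ∈ S, u.degree = d) : minGens (monIdeal K S) = S := by
  have eq_of_le : ∀ s ∈ S, ∀ t ∈ S, s ≤ t → s = t := by
    intro s hs t ht hst
    obtain ⟨r, rfl⟩ := exists_add_of_le hst
    have h1 := hS _ hs
    have h2 := hS _ ht
    rw [map_add] at h2
    have : r = 0 := (degree_eq_zero_iff r).1 (by omega)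
    simp [this]
  ext u
  constructor
  · rintro ⟨hu, hmin⟩
    obtain ⟨s, hs, hsu⟩ := monomial_mem_monIdeal.1 hu
    have := hmin (monomial_mem_monIdeal.2 ⟨s, hs, le_rfl⟩) hsu
    rwa [← hsu.antisymm this]
  · intro hu
    refine ⟨monomial_mem_monIdeal.2 ⟨u, hu, le_rfl⟩, fun v hv hvu => ?_⟩
    obtain ⟨s, hs, hsv⟩ := monomial_mem_monIdeal.1 hv
    rwa [← eq_of_le s hs u hu (hsv.trans hvu)]

theorem monIdeal_minGens {I : Ideal (MvPolynomial (Fin n) K)} (hI : IsMonomialIdeal I) :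
    monIdeal K (minGens I) = I := by
  obtain ⟨S, rfl⟩ := hI
  apply le_antisymm
  · refine Ideal.span_le.2 ?_
    rintro _ ⟨u, hu, rfl⟩
    exact hu.1
  · refine Ideal.span_le.2 ?_
    rintro _ ⟨s, hs, rfl⟩
    obtain ⟨m, hms, hm⟩ := exists_minimal_le_of_wellFoundedLT
      (fun v : Fin n →₀ ℕ => monomial v (1 : K) ∈ Ideal.span ((fun u => monomial u (1 : K)) '' S))
      s (Ideal.subset_span ⟨s, hs, rfl⟩)
    exact monomial_mem_monIdeal.2 ⟨m, hm, hms⟩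

open Pointwise in
theorem monIdeal_mul : monIdeal K S * monIdeal K T = monIdeal K (S + T) := by
  rw [monIdeal, monIdeal, Ideal.span_mul_span', monIdeal]
  congr 1
  ext f
  simp only [Set.mem_mul, Set.mem_image, Set.mem_add]
  constructor
  · rintro ⟨_, ⟨s, hs, rfl⟩, _, ⟨t, ht, rfl⟩, rfl⟩
    exact ⟨s + t, ⟨s, hs, t, ht, rfl⟩, by simp [monomial_mul]⟩
  · rintro ⟨_, ⟨s, hs, t, ht, rfl⟩, rfl⟩
    exact ⟨_, ⟨s, hs, rfl⟩, _, ⟨t, ht, rfl⟩, by simp [monomial_mul]⟩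

theorem varIdeal_eq_monIdeal : varIdeal K A = monIdeal K ((fun i => single i 1) '' A) := by
  rw [varIdeal, monIdeal, Set.image_image]
  rfl

theorem isMonomialIdeal_monIdeal : IsMonomialIdeal (monIdeal K S) := ⟨S, rfl⟩

theorem isMonomialIdeal_varIdeal : IsMonomialIdeal (varIdeal K A) :=
  varIdeal_eq_monIdeal (K := K) ▸ isMonomialIdeal_monIdeal

theorem minGens_varIdeal : minGens (varIdeal K A) = (fun i => single i 1) '' A := by
  rw [varIdeal_eq_monIdeal]
  refine minGens_monIdeal (d := 1) ?_
  rintro _ ⟨i, -, rfl⟩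
  exact degree_single i 1

theorem supp_varIdeal : supp (varIdeal K A) = A := by
  ext i
  rw [supp, minGens_varIdeal]
  simp [single_apply]

open Pointwise in
theorem varIdeal_pow (c : ℕ) :
    varIdeal K A ^ c = monIdeal K {m | (∀ i ∉ A, m i = 0) ∧ m.degree = c} := by
  induction c with
  | zero =>
    rw [pow_zero, Ideal.one_eq_top, eq_comm, Ideal.eq_top_iff_one]
    exact monomial_mem_monIdeal.2 ⟨0, by simp, le_rfl⟩
  | succ c ih =>
    rw [pow_succ, ih, varIdeal_eq_monIdeal, monIdeal_mul]
    congr 1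
    ext m
    simp only [Set.mem_add, Set.mem_image, Set.mem_ofPred_eq]
    constructor
    · rintro ⟨m, ⟨hm, rfl⟩, _, ⟨i, hi, rfl⟩, rfl⟩
      refine ⟨fun j hj => ?_, by rw [map_add, degree_single]⟩
      have : i ≠ j := fun e => hj (e ▸ hi)
      simp [hm j hj, this]
    · rintro ⟨hm, hc⟩
      obtain ⟨j, hj⟩ := exists_ne_zero_of_degree_ne_zero (u := m) (by omega)
      obtain ⟨w, rfl⟩ := exists_eq_add_single hj
      rw [map_add, degree_single] at hc
      refine ⟨w, ⟨fun i hi => ?_, by omega⟩, _, ⟨j, by_contra fun h0 => hj (hm j h0), rfl⟩, rfl⟩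
      have := hm i hi
      rw [Finsupp.add_apply] at this
      omega

theorem mem_varIdeal_pow {c : ℕ} {f : MvPolynomial (Fin n) K} :
    f ∈ varIdeal K A ^ c ↔ ∀ u ∈ f.support, c ≤ mass A u := by
  rw [varIdeal_pow, mem_monIdeal]
  refine forall₂_congr fun u _ => ?_
  constructor
  · rintro ⟨m, ⟨hm, rfl⟩, hmu⟩
    rw [← mass_eq_degree hm]
    exact mass_mono hmu
  · intro h
    obtain ⟨y, m, rfl, hy, hm⟩ := exists_split A u
    rw [map_add, mass_eq_zero hy, mass_eq_degree hm, zero_add] at h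
    obtain ⟨m', hle, hc⟩ := exists_le_degree_eq m c h
    refine ⟨m', ⟨fun i hi => ?_, hc⟩, hle.trans le_add_self⟩
    have := hle i
    rw [hm i hi] at this
    omega

/-- Powers of `varIdeal K A` are the steps of the filtration by order in the variables of `A`. -/
theorem mem_varIdeal_pow_iff_le_weightedOrder {c : ℕ} {f : MvPolynomial (Fin n) K} :
    f ∈ varIdeal K A ^ c ↔
      (c : ℕ∞) ≤ MvPowerSeries.weightedOrder (A.indicator 1) (f : MvPowerSeries (Fin n) K) := by
  rw [mem_varIdeal_pow]
  constructor
  · intro h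
    refine MvPowerSeries.nat_le_weightedOrder _ fun u hu => ?_
    rw [coeff_coe]
    by_contra h0
    exact absurd (h u (MvPolynomial.mem_support_iff.2 h0)) (not_le.2 hu)
  · intro h u hu
    rw [MvPolynomial.mem_support_iff, ← coeff_coe] at hu
    exact_mod_cast h.trans (MvPowerSeries.weightedOrder_le _ hu)

theorem weightedOrder_eq_zero_of_notMem {f : MvPolynomial (Fin n) K} (hf : f ∉ varIdeal K A) :
    MvPowerSeries.weightedOrder (A.indicator 1) (f : MvPowerSeries (Fin n) K) = 0 := by
  rw [← pow_one (varIdeal K A), mem_varIdeal_pow_iff_le_weightedOrder, Nat.cast_one,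
    Order.one_le_iff_ne_zero] at hf
  simpa using hf

theorem isPrime_varIdeal : (varIdeal K A).IsPrime := by
  refine ⟨fun h => ?_, fun {f g} hfg => ?_⟩
  · have h1 : (1 : MvPolynomial (Fin n) K) ∈ varIdeal K A ^ 1 := by simp [h]
    have := mem_varIdeal_pow.1 h1 0 (by simp)
    simp at this
  · by_contra! h
    rw [← pow_one (varIdeal K A), mem_varIdeal_pow_iff_le_weightedOrder, MvPolynomial.coe_mul,
      MvPowerSeries.weightedOrder_mul, weightedOrder_eq_zero_of_notMem h.1,
      weightedOrder_eq_zero_of_notMem h.2] at hfg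
    simp at hfg

theorem mem_varIdeal_pow_of_mul_mem {c : ℕ} {f g : MvPolynomial (Fin n) K}
    (hg : g ∉ varIdeal K A) (h : g * f ∈ varIdeal K A ^ c) : f ∈ varIdeal K A ^ c := by
  rw [mem_varIdeal_pow_iff_le_weightedOrder] at h ⊢
  rwa [MvPolynomial.coe_mul, MvPowerSeries.weightedOrder_mul, weightedOrder_eq_zero_of_notMem hg,
    zero_add] at h

/-- A monomial prime is generated by the variables in its support. -/
theorem eq_varIdeal_supp {p : Ideal (MvPolynomial (Fin n) K)} (hp : p.IsPrime)
    (hm : IsMonomialIdeal p) : p = varIdeal K (supp p) := by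
  suffices h : p = varIdeal K {i | X i ∈ p} by
    conv_rhs => rw [h, supp_varIdeal]
    exact h
  apply le_antisymm
  · refine (monIdeal_minGens hm).ge.trans (Ideal.span_le.2 ?_)
    rintro _ ⟨u, hu, rfl⟩
    have hu : monomial u (1 : K) ∈ p := hu.1
    rw [monomial_eq, C_1, one_mul, Finsupp.prod] at hu
    obtain ⟨i, hi, hX⟩ := (hp.prod_mem_iff).1 hu
    have hXi := hp.mem_of_pow_mem _ hX
    refine mem_ideal_span_X_image.2 fun v hv => ⟨i, hXi, ?_⟩
    rw [Finset.mem_singleton.1 (support_monomial_subset hv)]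
    exact Finsupp.mem_support_iff.1 hi
  · refine Ideal.span_le.2 ?_
    rintro _ ⟨i, hi, rfl⟩
    exact hi

/-- For coprime monomial generators, product and intersection agree. -/
theorem varIdeal_pow_mul_eq_inf {c : ℕ} (hT : ∀ t ∈ T, ∀ i ∈ A, t i = 0) :
    varIdeal K A ^ c * monIdeal K T = varIdeal K A ^ c ⊓ monIdeal K T := by
  refine le_antisymm Ideal.mul_le_inf ?_
  rintro f ⟨h1, h2⟩
  rw [SetLike.mem_coe, varIdeal_pow, mem_monIdeal] at h1
  rw [SetLike.mem_coe, mem_monIdeal] at h2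
  rw [varIdeal_pow, monIdeal_mul, mem_monIdeal]
  intro u hu
  obtain ⟨m, hm, hmu⟩ := h1 u hu
  obtain ⟨t, ht, htu⟩ := h2 u hu
  refine ⟨m + t, Set.add_mem_add hm ht, fun i => ?_⟩
  rw [Finsupp.add_apply]
  by_cases hi : i ∈ A
  · rw [hT t ht i hi]
    exact hmu i
  · rw [hm.1 i hi, zero_add]
    exact htu i

/-! ### Associated primes of monomial ideals -/

theorem mem_associatedPrimes_quotient {R : Type*} [CommRing R] [IsNoetherianRing R]
    {I P : Ideal R} :
    P ∈ associatedPrimes R (R ⧸ I) ↔ P.IsPrime ∧ ∃ f, ∀ g, g ∈ P ↔ g * f ∈ I := by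
  rw [AssociatedPrimes.mem_iff, isAssociatedPrime_iff]
  refine and_congr_right fun _ => ?_
  have key : ∀ f g : R, g ∈ (⊥ : Submodule R (R ⧸ I)).colon {Ideal.Quotient.mk I f} ↔
      g * f ∈ I := by
    intro f g
    rw [Submodule.mem_colon_singleton, Submodule.mem_bot, Algebra.smul_def,
      Ideal.Quotient.algebraMap_eq, ← map_mul, Ideal.Quotient.eq_zero_iff_mem]
  constructor
  · rintro ⟨x, rfl⟩
    obtain ⟨f, rfl⟩ := Ideal.Quotient.mk_surjective x
    exact ⟨f, key f⟩
  · rintro ⟨f, hf⟩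
    exact ⟨Ideal.Quotient.mk I f, by ext g; rw [hf, key]⟩

theorem le_of_mem_associatedPrimes {R : Type*} [CommRing R] [IsNoetherianRing R]
    {I P : Ideal R} (h : P ∈ associatedPrimes R (R ⧸ I)) : I ≤ P := by
  obtain ⟨-, f, hf⟩ := mem_associatedPrimes_quotient.1 h
  exact fun g hg => (hf g).2 (I.mul_mem_right f hg)

/-- All associated primes of an unmixed ideal have the height of the ideal. -/
theorem IsUnmixed.height_eq {R : Type*} [CommRing R] [IsNoetherianRing R] {I P : Ideal R}
    (hI : IsUnmixed I) (hP : P ∈ associatedPrimes R (R ⧸ I)) : P.height = I.height := by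
  refine le_antisymm ?_ (Ideal.height_mono (le_of_mem_associatedPrimes hP))
  rw [I.height_eq_inf_minimalPrimes]
  refine le_iInf₂ fun Q hQ => (hI P hP Q ?_).le
  apply Module.associatedPrimes.minimalPrimes_annihilator_subset_associatedPrimes
  rwa [Ideal.annihilator_quotient]

theorem eq_of_mem_associatedPrimes_varIdeal_pow {c : ℕ} {f : MvPolynomial (Fin n) K}
    {P : Ideal (MvPolynomial (Fin n) K)} (hP : P.IsPrime)
    (hf : ∀ g, g ∈ P ↔ g * f ∈ varIdeal K A ^ c) : P = varIdeal K A := by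
  have hfc : f ∉ varIdeal K A ^ c := fun h =>
    hP.ne_top ((Ideal.eq_top_iff_one _).2 ((hf 1).2 (by rwa [one_mul])))
  apply le_antisymm
  · intro g hg
    by_contra h
    exact hfc (mem_varIdeal_pow_of_mul_mem h ((hf g).1 hg))
  · exact hP.le_of_pow_le (n := c) fun g hg => (hf g).2 (Ideal.mul_mem_right _ _ hg)

/-- With generators of the second factor off `A`, the product has no associated primes besides
those of its factors. -/
theorem associatedPrimes_varIdeal_pow_mul {c : ℕ} (hT : ∀ t ∈ T, ∀ i ∈ A, t i = 0)
    {P : Ideal (MvPolynomial (Fin n) K)}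
    (hP : P ∈ associatedPrimes _ (MvPolynomial (Fin n) K ⧸ varIdeal K A ^ c * monIdeal K T)) :
    P = varIdeal K A ∨ P ∈ associatedPrimes _ (MvPolynomial (Fin n) K ⧸ monIdeal K T) := by
  rw [varIdeal_pow_mul_eq_inf hT, mem_associatedPrimes_quotient] at hP
  obtain ⟨hPp, f, hf⟩ := hP
  have hmul : ∀ g h, g * f ∈ varIdeal K A ^ c → h * f ∈ monIdeal K T → g * h ∈ P := by
    intro g h hg hh
    refine (hf _).2 ⟨?_, ?_⟩
    · rw [mul_right_comm]
      exact Ideal.mul_mem_right _ _ hg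
    · rw [mul_assoc]
      exact Ideal.mul_mem_left _ _ hh
  -- `P` is the intersection of the two colon ideals, hence equal to one of them
  by_cases h : ∀ g, g * f ∈ varIdeal K A ^ c → g ∈ P
  · exact .inl (eq_of_mem_associatedPrimes_varIdeal_pow hPp
      fun g => ⟨fun hg => ((hf g).1 hg).1, h g⟩)
  · push Not at h
    obtain ⟨g, hg, hgP⟩ := h
    refine .inr (mem_associatedPrimes_quotient.2 ⟨hPp, f, fun h => ⟨fun hh => ((hf h).1 hh).2,
      fun hh => (hPp.mem_or_mem (hmul g h hg hh)).resolve_left hgP⟩⟩)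

theorem mem_associatedPrimes_varIdeal_pow_mul {c : ℕ} (hT : ∀ t ∈ T, ∀ i ∈ A, t i = 0)
    (hA : A.Nonempty) {P : Ideal (MvPolynomial (Fin n) K)}
    (hP : P ∈ associatedPrimes _ (MvPolynomial (Fin n) K ⧸ monIdeal K T)) :
    P ∈ associatedPrimes _ (MvPolynomial (Fin n) K ⧸ varIdeal K A ^ c * monIdeal K T) := by
  rw [varIdeal_pow_mul_eq_inf hT]
  rw [mem_associatedPrimes_quotient] at hP ⊢
  obtain ⟨hPp, f, hf⟩ := hP
  obtain ⟨l, hl⟩ := hA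
  -- a power of a variable of `A` lies in the first factor and is regular modulo the second
  refine ⟨hPp, f * monomial (single l c) 1, fun g => (hf g).trans ⟨fun hg => ?_, fun hg => ?_⟩⟩
  · refine ⟨?_, ?_⟩
    · rw [← mul_assoc]
      refine Ideal.mul_mem_left _ _ (mem_varIdeal_pow.2 fun u hu => ?_)
      rw [Finset.mem_singleton.1 (support_monomial_subset hu), mass_single_of_mem hl]
    · rw [← mul_assoc]
      exact Ideal.mul_mem_right _ _ hg
  · have hg := hg.2
    rw [SetLike.mem_coe, ← mul_assoc, mul_monomial_mem_monIdeal] at hg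
    refine mem_monIdeal.2 fun u hu => ?_
    obtain ⟨s, hs, hsu⟩ := hg u hu
    refine ⟨s, hs, fun i => ?_⟩
    by_cases hi : i = l
    · simp [hi, hT s hs l hl]
    · have := hsu i
      rwa [Finsupp.add_apply, single_eq_of_ne hi, add_zero] at this

/-- For `w` of degree one less than the generators, the colon ideal by `x ^ w` is generated by the
variables in the link of `w`. -/
theorem IsBaseSet.varIdeal_link_mem_associatedPrimes (hG : IsBaseSet G d) {w : Fin n →₀ ℕ}
    (hw : (link G w).Nonempty) :
    varIdeal K (link G w) ∈ associatedPrimes _ (MvPolynomial (Fin n) K ⧸ monIdeal K G) := by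
  refine mem_associatedPrimes_quotient.2 ⟨isPrime_varIdeal, monomial w 1, fun g => ?_⟩
  rw [mul_monomial_mem_monIdeal, varIdeal, mem_ideal_span_X_image]
  refine forall₂_congr fun u _ => ⟨?_, ?_⟩
  · rintro ⟨i, hi, hui⟩
    refine ⟨_, hi, ?_⟩
    rw [add_comm]
    refine add_le_add_left (single_le_iff.2 ?_) w
    omega
  · rintro ⟨s, hs, hsu⟩
    obtain ⟨i, hi⟩ := hw
    by_cases hiw : s i ≤ w i
    · obtain ⟨j, hj, hjG⟩ := hG.exchange _ _ hi _ hs hiw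
      have := hsu j
      simp only [Finsupp.add_apply] at hj this
      exact ⟨j, hjG, by omega⟩
    · have := hsu i
      rw [Finsupp.add_apply] at this
      exact ⟨i, hi, by omega⟩

/-- Links of an unmixed polymatroidal ideal are incomparable, since the primes they generate have
the same finite height. -/
theorem IsBaseSet.link_eq_of_subset (hG : IsBaseSet G d) (hU : IsUnmixed (monIdeal K G))
    (w w' : Fin n →₀ ℕ) (hw : (link G w).Nonempty) (hww' : link G w ⊆ link G w') :
    link G w = link G w' := by
  have h := hU _ (hG.varIdeal_link_mem_associatedPrimes hw) _
    (hG.varIdeal_link_mem_associatedPrimes (hw.mono hww'))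
  have : (varIdeal K (link G w)).IsPrime := isPrime_varIdeal
  have heq : varIdeal K (link G w) = varIdeal K (link G w') :=
    Ideal.eq_of_le_of_height_le _ (Ideal.span_mono (Set.image_mono hww')) h.ge
  rw [← supp_varIdeal (K := K) (A := link G w), heq, supp_varIdeal]

/-! ### Polymatroidal ideals and base sets -/

theorem IsPolymatroidal.isBaseSet {I : Ideal (MvPolynomial (Fin n) K)} (hI : IsPolymatroidal I d) :
    IsBaseSet (minGens I) d where
  nonempty := by
    rw [Set.nonempty_iff_ne_empty]
    intro h
    apply hI.ne_bot
    rw [← monIdeal_minGens hI.isMonomialIdeal, h, monIdeal, Set.image_empty, Ideal.span_empty]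
  degree_eq := hI.degree_eq
  exchange w i hw v hv hvi := by
    obtain ⟨j, hj, hjG⟩ := hI.exchange _ hw v hv i (by
      rw [Finsupp.add_apply, single_eq_same]
      omega)
    rw [add_tsub_cancel_right] at hjG
    exact ⟨j, hj, hjG⟩

theorem IsBaseSet.isPolymatroidal (hG : IsBaseSet G d) : IsPolymatroidal (monIdeal K G) d := by
  have hmin : minGens (monIdeal K G) = G := minGens_monIdeal hG.degree_eq
  refine ⟨isMonomialIdeal_monIdeal, fun h => ?_, by rw [hmin]; exact hG.degree_eq, ?_⟩
  · obtain ⟨u, hu⟩ := hG.nonempty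
    have : monomial u (1 : K) ∈ monIdeal K G := monomial_mem_monIdeal.2 ⟨u, hu, le_rfl⟩
    rw [h, Ideal.mem_bot, monomial_eq_zero] at this
    exact one_ne_zero this
  · rw [hmin]
    intro u hu v hv i hi
    obtain ⟨w, rfl⟩ := exists_eq_add_single (u := u) (i := i) (by omega)
    rw [add_tsub_cancel_right]
    refine hG.exchange w i hu v hv ?_
    rw [Finsupp.add_apply, single_eq_same] at hi
    omega

/-! ### Factorization of unmixed polymatroidal ideals -/

/-- If some minimal generator of an unmixed polymatroidal ideal is not squarefree, a power of a
monomial associated prime splits off. -/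
theorem IsPolymatroidal.exists_splitOff {I : Ideal (MvPolynomial (Fin n) K)}
    (hI : IsPolymatroidal I d) (hU : IsUnmixed I) {u : Fin n →₀ ℕ} (hu : u ∈ minGens I)
    {l : Fin n} (hl : 2 ≤ u l) :
    ∃ (A : Set (Fin n)) (c d' : ℕ) (I' : Ideal (MvPolynomial (Fin n) K)),
      0 < c ∧ c + d' = d ∧ I = varIdeal K A ^ c * I' ∧ IsPolymatroidal I' d' ∧
      varIdeal K A ∈ associatedPrimes (MvPolynomial (Fin n) K) (MvPolynomial (Fin n) K ⧸ I) ∧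
      associatedPrimes (MvPolynomial (Fin n) K) (MvPolynomial (Fin n) K ⧸ I') ⊆
        associatedPrimes (MvPolynomial (Fin n) K) (MvPolynomial (Fin n) K ⧸ I) ∧
      Disjoint A (supp I') ∧ A ⊆ supp I ∧ supp I' ⊆ supp I := by
  have hG := hI.isBaseSet
  have hIG := monIdeal_minGens hI.isMonomialIdeal
  have hH := hG.link_eq_of_subset (K := K) (by rwa [hIG])
  obtain ⟨w, A, z, c, hA, hB⟩ := hG.exists_isBlock hH hu hl
  obtain ⟨d', hd', hG'⟩ := hB.isBaseSet_offPart hG hH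
  have hc := hB.two_le
  have hfac : I = varIdeal K A ^ c * monIdeal K (offPart (minGens I) A) := by
    rw [varIdeal_pow, monIdeal_mul, ← hB.eq_add_offPart hG hH, hIG]
  have hmin : minGens (monIdeal K (offPart (minGens I) A)) = offPart (minGens I) A :=
    minGens_monIdeal hG'.degree_eq
  refine ⟨A, c, d', _, by omega, hd', hfac, hG'.isPolymatroidal, ?_, ?_, ?_, ?_, ?_⟩
  · have := hG.varIdeal_link_mem_associatedPrimes (K := K) (w := w) (hA ▸ hB.nonempty)
    rwa [hIG, ← hA] at this
  · intro P hP
    have := mem_associatedPrimes_varIdeal_pow_mul (c := c) (fun y hy => hy.1) hB.nonempty hP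
    rwa [← hfac] at this
  · rw [Set.disjoint_left]
    rintro i hi ⟨y, hy, hyi⟩
    rw [hmin] at hy
    exact hyi (hy.1 i hi)
  · intro i hi
    rw [hA] at hi
    exact ⟨_, hi, by simp⟩
  · rintro i ⟨y, hy, hyi⟩
    rw [hmin] at hy
    obtain ⟨-, m, -, hm⟩ := hy
    exact ⟨_, hm, by rw [Finsupp.add_apply]; omega⟩

/-- An unmixed polymatroidal ideal is a product of powers of associated monomial primes and a
matroidal ideal, in pairwise disjoint sets of variables. -/
theorem IsPolymatroidal.exists_factorization (d : ℕ) : ∀ I : Ideal (MvPolynomial (Fin n) K),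
    IsPolymatroidal I d → IsUnmixed I →
    ∃ (t : ℕ) (p : Fin t → Ideal (MvPolynomial (Fin n) K)) (a : Fin t → ℕ)
      (J : Ideal (MvPolynomial (Fin n) K)) (e : ℕ),
      (∀ i, 0 < a i) ∧ (∀ i, (p i).IsPrime ∧ IsMonomialIdeal (p i)) ∧
      (∀ i, p i ∈ associatedPrimes (MvPolynomial (Fin n) K) (MvPolynomial (Fin n) K ⧸ I)) ∧
      IsMatroidal J e ∧
      associatedPrimes (MvPolynomial (Fin n) K) (MvPolynomial (Fin n) K ⧸ J) ⊆
        associatedPrimes (MvPolynomial (Fin n) K) (MvPolynomial (Fin n) K ⧸ I) ∧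
      (∀ i j, i ≠ j → Disjoint (supp (p i)) (supp (p j))) ∧
      (∀ i, Disjoint (supp (p i)) (supp J)) ∧ (∀ i, supp (p i) ⊆ supp I) ∧ supp J ⊆ supp I ∧
      (∑ i, a i) + e = d ∧ I = (∏ i, p i ^ a i) * J := by
  induction d using Nat.strong_induction_on with
  | h d ih =>
  intro I hI hU
  by_cases hsq : ∀ u ∈ minGens I, ∀ i, u i ≤ 1
  · exact ⟨0, Fin.elim0, Fin.elim0, I, d, nofun, nofun, nofun, ⟨hI, hsq⟩, subset_rfl, nofun, nofun,
      nofun, subset_rfl, by simp, by simp⟩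
  · push Not at hsq
    obtain ⟨u, hu, l, hl⟩ := hsq
    obtain ⟨A, c, d', I', hc, hd, hfac, hI', hA, hass, hdisj, hAs, hs⟩ :=
      hI.exists_splitOff hU hu hl
    obtain ⟨t, p, a, J, e, ha, hp, hpa, hJ, hJa, hpp, hpJ, hps, hJs, hsum, hprod⟩ :=
      ih d' (by omega) I' hI' fun P hP Q hQ => hU P (hass hP) Q (hass hQ)
    have hdA : ∀ i, Disjoint A (supp (p i)) := fun i => hdisj.mono_right (hps i)
    refine ⟨t + 1, Fin.cons (varIdeal K A) p, Fin.cons c a, J, e, ?_, ?_, ?_, hJ, hJa.trans hass,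
      ?_, ?_, ?_, hJs.trans hs, ?_, ?_⟩
    · simpa [Fin.forall_fin_succ] using ⟨hc, ha⟩
    · simpa only [Fin.forall_fin_succ, Fin.cons_zero, Fin.cons_succ] using
        ⟨⟨isPrime_varIdeal, isMonomialIdeal_varIdeal⟩, hp⟩
    · simpa only [Fin.forall_fin_succ, Fin.cons_zero, Fin.cons_succ] using
        ⟨hA, fun i => hass (hpa i)⟩
    · intro i j
      refine Fin.cases ?_ (fun i => ?_) i <;> refine Fin.cases ?_ (fun j => ?_) j
      · exact fun h => absurd rfl h
      · intro _
        rw [Fin.cons_zero, Fin.cons_succ, supp_varIdeal]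
        exact hdA j
      · intro _
        rw [Fin.cons_zero, Fin.cons_succ, supp_varIdeal]
        exact (hdA i).symm
      · intro h
        rw [Fin.cons_succ, Fin.cons_succ]
        exact hpp i j fun e => h (by rw [e])
    · simpa only [Fin.forall_fin_succ, Fin.cons_zero, Fin.cons_succ, supp_varIdeal] using
        ⟨hdisj.mono_right hJs, hpJ⟩
    · simpa only [Fin.forall_fin_succ, Fin.cons_zero, Fin.cons_succ, supp_varIdeal] using
        ⟨hAs, fun i => (hps i).trans hs⟩
    · rw [Fin.sum_univ_succ]
      simp only [Fin.cons_zero, Fin.cons_succ]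
      omega
    · rw [Fin.prod_univ_succ]
      simp only [Fin.cons_zero, Fin.cons_succ]
      rw [mul_assoc, ← hprod, ← hfac]

/-! ### Unmixedness of products in disjoint variables -/

/-- A product of powers of monomial primes and a monomial ideal in disjoint sets of variables has
no associated primes other than those of its factors. -/
theorem associatedPrimes_prod_mul {ι : Type*} {p : ι → Ideal (MvPolynomial (Fin n) K)} (a : ι → ℕ)
    (hp : ∀ i, (p i).IsPrime ∧ IsMonomialIdeal (p i))
    (hpp : ∀ i j, i ≠ j → Disjoint (supp (p i)) (supp (p j)))
    (hT : ∀ i, ∀ t ∈ T, ∀ x ∈ supp (p i), t x = 0) (s : Finset ι) :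
    (∃ T' : Set (Fin n →₀ ℕ), (∏ i ∈ s, p i ^ a i) * monIdeal K T = monIdeal K T' ∧
      ∀ i ∉ s, ∀ t ∈ T', ∀ x ∈ supp (p i), t x = 0) ∧
    ∀ P ∈ associatedPrimes (MvPolynomial (Fin n) K)
        (MvPolynomial (Fin n) K ⧸ (∏ i ∈ s, p i ^ a i) * monIdeal K T),
      (∃ i, P = p i) ∨
        P ∈ associatedPrimes (MvPolynomial (Fin n) K) (MvPolynomial (Fin n) K ⧸ monIdeal K T) := by
  classical
  induction s using Finset.induction_on with
  | empty =>
    rw [Finset.prod_empty, one_mul]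
    exact ⟨⟨T, rfl, fun i _ => hT i⟩, fun P hP => .inr hP⟩
  | insert k s hk ih =>
    obtain ⟨⟨T', hT', hoff⟩, hass⟩ := ih
    have hpk := eq_varIdeal_supp (hp k).1 (hp k).2
    rw [hT'] at hass
    rw [Finset.prod_insert hk, mul_assoc, hT', hpk]
    refine ⟨⟨_, by rw [varIdeal_pow, monIdeal_mul], ?_⟩, fun P hP => ?_⟩
    · rintro i hi _ ⟨m, ⟨hm, -⟩, t, ht, rfl⟩ x hx
      rw [Finset.mem_insert, not_or] at hi
      rw [Finsupp.add_apply, hoff i hi.2 t ht x hx,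
        hm x fun hxk => Set.disjoint_left.1 (hpp i k hi.1) hx hxk]
    · rcases associatedPrimes_varIdeal_pow_mul (hoff k hk) hP with h | h
      · exact .inl ⟨k, by rw [h, ← hpk]⟩
      · exact hass P h

theorem isUnmixed_varIdeal_pow (c : ℕ) : IsUnmixed (varIdeal K A ^ c) := by
  have h : ∀ P ∈ associatedPrimes (MvPolynomial (Fin n) K)
      (MvPolynomial (Fin n) K ⧸ varIdeal K A ^ c), P = varIdeal K A := by
    intro P hP
    obtain ⟨hPp, f, hf⟩ := mem_associatedPrimes_quotient.1 hP
    exact eq_of_mem_associatedPrimes_varIdeal_pow hPp hf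
  intro P hP Q hQ
  rw [h P hP, h Q hQ]

/-- The product is unmixed as soon as all associated primes of the factors have one height. -/
theorem isUnmixed_prod_mul {t : ℕ} {p : Fin t → Ideal (MvPolynomial (Fin n) K)} (a : Fin t → ℕ)
    {J : Ideal (MvPolynomial (Fin n) K)} (hp : ∀ i, (p i).IsPrime ∧ IsMonomialIdeal (p i))
    (hpp : ∀ i j, i ≠ j → Disjoint (supp (p i)) (supp (p j))) (hJ : IsMonomialIdeal J)
    (hpJ : ∀ i, Disjoint (supp (p i)) (supp J)) {h : ℕ∞} (hph : ∀ i, (p i).height = h)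
    (hJh : ∀ P ∈ associatedPrimes (MvPolynomial (Fin n) K) (MvPolynomial (Fin n) K ⧸ J),
      P.height = h) :
    IsUnmixed ((∏ i, p i ^ a i) * J) := by
  have hass := (associatedPrimes_prod_mul (T := minGens J) a hp hpp
    (fun i u hu x hx => by_contra fun h0 => Set.disjoint_left.1 (hpJ i) hx ⟨u, hu, h0⟩)
    Finset.univ).2
  rw [monIdeal_minGens hJ] at hass
  have key : ∀ P ∈ associatedPrimes (MvPolynomial (Fin n) K)
      (MvPolynomial (Fin n) K ⧸ (∏ i, p i ^ a i) * J), P.height = h := by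
    intro P hP
    rcases hass P hP with ⟨i, rfl⟩ | hP
    · exact hph i
    · exact hJh P hP
  intro P hP Q hQ
  rw [key P hP, key Q hQ]

end

end Polymatroidal

theorem theorem2p11 {K : Type*} [Field K] (n d : ℕ) (I : Ideal (MvPolynomial (Fin n) K))
    (hI : Polymatroidal.IsPolymatroidal I d) :
    Polymatroidal.IsUnmixed I ↔
      (I = MvPolynomial.idealOfVars (Fin n) K ^ d) ∨
      (∃ (t : ℕ) (p : Fin t → Ideal (MvPolynomial (Fin n) K)) (a : Fin t → ℕ),
        0 < t ∧ (∀ i, 0 < a i) ∧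
        (∀ i, (p i).IsPrime ∧ Polymatroidal.IsMonomialIdeal (p i)) ∧
        (∀ i j, (p i).height = (p j).height) ∧
        (∀ i j, i ≠ j → Disjoint (Polymatroidal.supp (p i)) (Polymatroidal.supp (p j))) ∧
        ∑ i, a i = d ∧
        I = ∏ i, p i ^ a i) ∨
      (∃ (t : ℕ) (p : Fin t → Ideal (MvPolynomial (Fin n) K)) (a : Fin t → ℕ)
        (J : Ideal (MvPolynomial (Fin n) K)) (e : ℕ),
        0 < t ∧ (∀ i, 0 < a i) ∧
        (∀ i, (p i).IsPrime ∧ Polymatroidal.IsMonomialIdeal (p i)) ∧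
        Polymatroidal.IsMatroidal J e ∧ Polymatroidal.IsUnmixed J ∧
        (∀ i j, (p i).height = (p j).height) ∧
        (∀ i, (p i).height = J.height) ∧
        (∀ i j, i ≠ j → Disjoint (Polymatroidal.supp (p i)) (Polymatroidal.supp (p j))) ∧
        (∀ i, Disjoint (Polymatroidal.supp (p i)) (Polymatroidal.supp J)) ∧
        (∑ i, a i) + e = d ∧
        I = (∏ i, p i ^ a i) * J) ∨
      (Polymatroidal.IsMatroidal I d ∧ Polymatroidal.IsUnmixed I) := by
  open Polymatroidal in
  constructor
  · intro hU
    obtain ⟨t, p, a, J, e, ha, hp, hpa, hJ, hJa, hpp, hpJ, -, -, hsum, hprod⟩ :=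
      IsPolymatroidal.exists_factorization d I hI hU
    have hJU : IsUnmixed J := fun P hP Q hQ => hU P (hJa hP) Q (hJa hQ)
    have hheight : ∀ i j, (p i).height = (p j).height := fun i j => hU _ (hpa i) _ (hpa j)
    rcases Nat.eq_zero_or_pos t with rfl | ht
    · rw [Finset.univ_eq_empty, Finset.sum_empty, zero_add] at hsum
      rw [Finset.univ_eq_empty, Finset.prod_empty, one_mul] at hprod
      subst hsum hprod
      exact .inr (.inr (.inr ⟨hJ, hU⟩))
    by_cases hJtop : J = ⊤
    · -- the matroidal factor is trivial, and its generator `1` has degree zero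
      have he : e = 0 := by
        obtain ⟨u, hu⟩ := hJ.toIsPolymatroidal.isBaseSet.nonempty
        have h0 : u = 0 := le_antisymm (hu.2 (by simp [hJtop]) zero_le) zero_le
        rw [← hJ.degree_eq u hu, h0, map_zero]
      rw [hJtop, ← Ideal.one_eq_top, mul_one] at hprod
      exact .inr (.inl ⟨t, p, a, ht, ha, hp, hheight, hpp, by omega, hprod⟩)
    · have : Nontrivial (MvPolynomial (Fin n) K ⧸ J) := Ideal.Quotient.nontrivial_iff.2 hJtop
      obtain ⟨Q, hQ⟩ := associatedPrimes.nonempty (MvPolynomial (Fin n) K)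
        (MvPolynomial (Fin n) K ⧸ J)
      refine .inr (.inr (.inl ⟨t, p, a, J, e, ht, ha, hp, hJ, hJU, hheight, fun i => ?_, hpp, hpJ,
        hsum, hprod⟩))
      rw [← hJU.height_eq hQ]
      exact hU _ (hpa i) _ (hJa hQ)
  · rintro (rfl | ⟨t, p, a, ht, -, hp, hheight, hpp, -, rfl⟩ |
      ⟨t, p, a, J, e, -, -, hp, hJ, hJU, -, hheight, hpp, hpJ, -, rfl⟩ | ⟨-, hU⟩)
    · have := isUnmixed_varIdeal_pow (K := K) (A := (Set.univ : Set (Fin n))) d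
      rwa [varIdeal, Set.image_univ] at this
    · have htop : minGens (⊤ : Ideal (MvPolynomial (Fin n) K)) = {0} := by
        ext u
        refine ⟨fun hu => le_antisymm (hu.2 (by simp) zero_le) zero_le, ?_⟩
        rintro rfl
        exact ⟨by simp, fun _ _ _ => zero_le⟩
      have := isUnmixed_prod_mul (J := ⊤) a hp hpp ⟨{0}, by simp⟩
        (fun i => by simp [supp, htop]) (h := (p ⟨0, ht⟩).height) (fun i => hheight i _)
        (fun P hP => ((mem_associatedPrimes_quotient.1 hP).1.ne_top
          (top_le_iff.1 (le_of_mem_associatedPrimes hP))).elim)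
      rwa [← Ideal.one_eq_top, mul_one] at this
    · exact isUnmixed_prod_mul a hp hpp hJ.isMonomialIdeal hpJ hheight
        fun P hP => hJU.height_eq hP
    · exact hU
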